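/- Let $N\ge 1$ and $v_1,\dots,v_N>0$. Consider the totally asymmetric simple exclusion process (TASEP) on $\mathbb{Z}$ in which particles keep their left-to-right order and particle $i$ attempts, at rate $v_i$ and independently of the others, to hop one site to the right, the hop being carried out if and only if the target site is empty. Fix $\epsilon>0$ with $\epsilon v_i<1$ for all $i$, and for $k\ge1$, $1\le l\le N+1$, $x\in\mathbb{Z}$, $t\ge 0$ let $$F_{k,l}(x,t)=\frac1{2\pi i}\oint_{|z|=\epsilon} e^{t/z}\,z^{x-1}\prod_{j=1}^{l-1}(1-v_jz)^{-1}\prod_{j=1}^{k-1}(1-v_jz)\,dz ,$$ $$Q_N(x,t)=\prod_{i=1}^N\left(e^{-tv_i}v_i^{\,x+N-1}\right)\det\bigl[F_{k,l+1}(x+N-k+l-1,t)\bigr]_{k,l=1}^N .$$ (Current distribution.) Let $t\ge0$ and $x\in\mathbb{Z}$. (a) Start the process with $N$ particles, labelled $1,\dots,N$ from left to right with rates $v_1,\dots,v_N$, from the configuration $(1-N,\dots,0)$. The probability that at time $t$ all $N$ particles are at sites $\ge x$ equals $Q_N(x,t)$. In particular, for $x\ge1$, the probability that all $N$ particles have crossed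 the bond $(x-1,x)$ by time $t$ equals $Q_N(x,t)$. (b) Start the process from the step initial condition, in which exactly the sites $\le 0$ are occupied, where the $N$ rightmost particles have, from left to right, the rates $v_1,\dots,v_N$ and the particles further left have arbitrary positive rates. The probability that the $N$-th particle from the right is at a site $\ge x$ at time $t$ equals $Q_N(x,t)$. For $x\ge1$, the probability that at least $N$ particles have crossed the bond $(x-1,x)$ by time $t$ equals $Q_N(x,t)$. -/

import Mathlib

open MeasureTheory ProbabilityTheory
open scoped NNReal

/-! ### The TASEP with particle-dependent hopping rates

Particles carry labels in a linearly ordered type `ι`, ordered from left to right. A configuration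
is a strictly increasing map `x : ι → ℤ`, where `x j` is the site of particle `j`. -/

open Classical in
/-- The generator: particle `j` tries to hop one site to the right at rate `v j`, and the hop takes
place provided that the target site is empty. It is only applied to functions `f` of finitely many
particles, for which the sum has finitely many nonzero terms. -/
noncomputable def tasepGenerator {ι : Type*} (v : ι → ℝ) (f : (ι → ℤ) → ℝ) (x : ι → ℤ) : ℝ :=
  ∑' j, if ∀ k, x k ≠ x j + 1 then v j * (f (Function.update x j (x j + 1)) - f x) else 0

/-- `X` is a TASEP with hopping rates `v` started from the configuration `y`: an adapted process
of configurations with right-continuous paths that solves the martingale problem of the generator,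
with the bounded functions of finitely many particle positions as test functions. -/
structure IsTASEP {ι : Type*} [LinearOrder ι] (v : ι → ℝ) (y : ι → ℤ)
    {Ω : Type*} {mΩ : MeasurableSpace Ω} (μ : Measure Ω) (ℱ : Filtration ℝ≥0 mΩ)
    (X : ℝ≥0 → Ω → ι → ℤ) : Prop where
  strictMono : ∀ t ω, StrictMono (X t ω)
  adapted : ∀ t j, Measurable[ℱ t] fun ω => X t ω j
  rightContinuous : ∀ ω j t, ContinuousWithinAt (fun s => X s ω j) (Set.Ici t) t
  initial : ∀ᵐ ω ∂μ, X 0 ω = y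
  martingale : ∀ (S : Finset ι) (f : (ι → ℤ) → ℝ), DependsOn f (S : Set ι) →
    (∃ C, ∀ x, |f x| ≤ C) →
    Martingale (fun (t : ℝ≥0) ω =>
      f (X t ω) - ∫ s in (0 : ℝ)..t, tasepGenerator v f (X s.toNNReal ω)) ℱ μ

/-- Particle `j` has crossed the bond `(x - 1, x)` by time `t`, along the path `ξ`: it started to
the left of the bond and is to the right of it at time `t` (all hops are to the right). -/
def HasCrossed {ι : Type*} (ξ : ℝ≥0 → ι → ℤ) (x : ℤ) (t : ℝ≥0) (j : ι) : Prop :=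
  ξ 0 j ≤ x - 1 ∧ x ≤ ξ t j

/-- The initial configuration `(1 - N, …, 0)` of `N` particles. -/
def blockConfig (N : ℕ) : Fin N → ℤ := fun i => (i : ℤ) + 1 - N

/-- The step initial configuration: all sites `≤ 0` are occupied. The particles are numbered
`0, 1, 2, …` from right to left, so the left-to-right order of labels is that of `ℕᵒᵈ`. -/
def stepConfig : ℕᵒᵈ → ℤ := fun j => -((OrderDual.ofDual j : ℕ) : ℤ)

/-- The function `F_{k,l}(x,t)` for rates `v_1, …, v_N`, with `k, l` counted from `1`, as an integral
over the circle of radius `ε` around the origin. The rate `v_i` is `v ⟨i - 1, _⟩`. -/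
noncomputable def tasepF {N : ℕ} (v : Fin N → ℝ) (ε : ℝ) (k l : ℕ) (x : ℤ) (t : ℝ) : ℂ :=
  (2 * (Real.pi : ℂ) * Complex.I)⁻¹ * ∮ z in C(0, ε),
    Complex.exp ((t : ℂ) / z) * z ^ (x - 1) *
      (∏ i : Fin N with i.val + 1 < l, (1 - (v i : ℂ) * z)⁻¹) *
      ∏ i : Fin N with i.val + 1 < k, (1 - (v i : ℂ) * z)

/-- The determinantal expression `Q_N(x,t)`. Rows and columns are counted from `0` here, so that
row `k` and column `l` hold the entry `F_{k+1,l+2}(x + N - 1 - k + l, t)`. -/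
noncomputable def tasepQ {N : ℕ} (v : Fin N → ℝ) (ε : ℝ) (x : ℤ) (t : ℝ) : ℂ :=
  (∏ i, Complex.exp (-(t : ℂ) * (v i : ℂ)) * (v i : ℂ) ^ (x + N - 1)) *
    (Matrix.of fun k l : Fin N =>
      tasepF v ε ((k : ℕ) + 1) ((l : ℕ) + 2) (x + N - 1 - (k : ℕ) + (l : ℕ)) t).det

/-! The probability that all particles are at sites `≥ x` solves the backward Kolmogorov equation in
the initial configuration `y`. The determinant supplies an explicit bounded solution, which is then
paired with the process.

Row `k` of `tasepDet` depends only on `y k`, and its entries solve the backward equation of a free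
particle. By multilinearity the determinant solves the equation for independent particles
(`hasDerivAt_tasepDet`). Exclusion enters through linear algebra: raising `y k` by one adds to row
`k` a vector built from `F_{k+2,·}`, which is a multiple of the next row when the next particle is
adjacent. A forbidden hop thus leaves the determinant unchanged (`tasepDet_update_of_blocked`).

The determinant is controlled only for `y k ≤ x + k`, hence the truncation `min (y k) (x + k)` in
`tasepProb`. It is compatible with the equation: a particle at its cap is blocked by the next one,
also at its cap, and the last row is constant beyond its cap by contour deformation to infinity
(`tasepDet_update_of_last`). At time zero the determinant is triangular or has a zero row, which
gives the indicator of the event.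

For any bounded solution `w`, the expectation of `w (X s) (T - s)` is constant in `s`
(`integral_backward_eq`), because the martingale problem and the backward equation cancel to first
order. Step initial data reduce to finitely many particles because those on the right evolve
autonomously (`IsTASEP.comp`). -/

/-! ### Contour integrals -/

theorem norm_exp_ofReal_div_le {ε s T : ℝ} (hε : 0 < ε) (hs : |s| ≤ T) {z : ℂ} (hz : ‖z‖ = ε) :
    ‖Complex.exp ((s : ℂ) / z)‖ ≤ Real.exp (T / ε) := by
  rw [Complex.norm_exp]
  refine Real.exp_le_exp.2 ((Complex.re_le_norm _).trans ?_)
  rw [norm_div, hz, Complex.norm_real, Real.norm_eq_abs]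
  gcongr

theorem ne_zero_of_mem_sphere_zero {ε : ℝ} (hε : 0 < ε) {z : ℂ} (hz : z ∈ Metric.sphere (0 : ℂ) ε) :
    z ≠ 0 := by
  rintro rfl
  simp at hz
  exact hε.ne hz

theorem continuousOn_exp_div_sphere {ε : ℝ} (hε : 0 < ε) (s : ℂ) :
    ContinuousOn (fun z : ℂ => Complex.exp (s / z)) (Metric.sphere 0 ε) :=
  (continuousOn_const.div continuousOn_id fun _ hz => ne_zero_of_mem_sphere_zero hε hz).cexp

theorem continuousOn_zpow_sphere {ε : ℝ} (hε : 0 < ε) (m : ℤ) :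
    ContinuousOn (fun z : ℂ => z ^ m) (Metric.sphere 0 ε) :=
  continuousOn_id.zpow₀ m fun _ hz => Or.inl (ne_zero_of_mem_sphere_zero hε hz)

theorem continuous_comp_circleMap {ε : ℝ} (hε : 0 < ε) {g : ℂ → ℂ}
    (hg : ContinuousOn g (Metric.sphere 0 ε)) : Continuous fun θ => g (circleMap 0 ε θ) :=
  hg.comp_continuous (continuous_circleMap 0 ε) fun θ => circleMap_mem_sphere 0 hε.le θ

theorem hasDerivAt_circleIntegral_exp_div {ε : ℝ} (hε : 0 < ε) {g : ℂ → ℂ}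
    (hg : ContinuousOn g (Metric.sphere 0 ε)) (t : ℝ) :
    HasDerivAt (fun s : ℝ => ∮ z in C(0, ε), Complex.exp ((s : ℂ) / z) * g z)
      (∮ z in C(0, ε), Complex.exp ((t : ℂ) / z) * (z⁻¹ * g z)) t := by
  obtain ⟨M, hM⟩ := (isCompact_sphere (0 : ℂ) ε).exists_bound_of_continuousOn hg
  have hinv : ContinuousOn (fun z : ℂ => z⁻¹) (Metric.sphere 0 ε) :=
    continuousOn_id.inv₀ fun _ hz => ne_zero_of_mem_sphere_zero hε hz
  have hcont : ∀ {f : ℂ → ℂ}, ContinuousOn f (Metric.sphere 0 ε) →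
      Continuous fun θ => deriv (circleMap 0 ε) θ • f (circleMap 0 ε θ) := fun hf => by
    simp only [deriv_circleMap]
    exact ((continuous_circleMap 0 ε).mul continuous_const).smul (continuous_comp_circleMap hε hf)
  refine (intervalIntegral.hasDerivAt_integral_of_dominated_loc_of_deriv_le
    (F := fun (s : ℝ) θ => deriv (circleMap 0 ε) θ •
      (Complex.exp ((s : ℂ) / circleMap 0 ε θ) * g (circleMap 0 ε θ)))
    (F' := fun (s : ℝ) θ => deriv (circleMap 0 ε) θ •
      (Complex.exp ((s : ℂ) / circleMap 0 ε θ) * ((circleMap 0 ε θ)⁻¹ * g (circleMap 0 ε θ))))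
    (bound := fun _ => ε * (Real.exp ((|t| + 1) / ε) * (ε⁻¹ * M)))
    (Metric.ball_mem_nhds t one_pos) ?_ ?_ ?_ ?_ ?_ ?_).2
  · exact Filter.Eventually.of_forall fun s =>
      (hcont ((continuousOn_exp_div_sphere hε s).mul hg)).aestronglyMeasurable
  · exact (hcont ((continuousOn_exp_div_sphere hε t).mul hg)).intervalIntegrable _ _
  · exact (hcont ((continuousOn_exp_div_sphere hε t).mul (hinv.mul hg))).aestronglyMeasurable
  · refine Filter.Eventually.of_forall fun θ _ s hs => ?_
    have hs' : |s| ≤ |t| + 1 := by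
      have h1 : |s - t| < 1 := by simpa [Real.dist_eq] using hs
      have h2 := abs_add_le (s - t) t
      simp only [sub_add_cancel] at h2
      linarith
    have hz : ‖circleMap 0 ε θ‖ = ε := by simpa using circleMap_mem_sphere 0 hε.le θ
    rw [norm_smul, norm_mul, norm_mul, norm_inv, hz]
    have : ‖deriv (circleMap 0 ε) θ‖ = ε := by simp [abs_of_pos hε]
    rw [this]
    gcongr
    · exact norm_exp_ofReal_div_le hε hs' hz
    · exact hM _ (circleMap_mem_sphere 0 hε.le θ)
  · exact intervalIntegrable_const
  · refine Filter.Eventually.of_forall fun θ _ s _ => ?_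
    have h : HasDerivAt (fun s : ℝ => Complex.exp ((s : ℂ) / circleMap 0 ε θ))
        (Complex.exp ((s : ℂ) / circleMap 0 ε θ) * (circleMap 0 ε θ)⁻¹) s := by
      simpa [div_eq_mul_inv] using
        ((Complex.ofRealCLM.hasDerivAt (x := s)).mul_const (circleMap 0 ε θ)⁻¹).cexp
    simpa [mul_assoc] using (h.mul_const (g (circleMap 0 ε θ))).const_mul
      (deriv (circleMap 0 ε) θ)

/-- The only singularity is at `0`, so the radius can be sent to infinity. There the exponential
stays bounded and `z ^ m` decays at least like `R⁻²`, against a length `2πR`. -/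
theorem circleIntegral_exp_div_mul_zpow_eq_zero {ε : ℝ} (hε : 0 < ε) (t : ℝ) {m : ℤ}
    (hm : m ≤ -2) : (∮ z in C(0, ε), Complex.exp ((t : ℂ) / z) * z ^ m) = 0 := by
  have hdiff : ∀ z : ℂ, z ≠ 0 →
      DifferentiableAt ℂ (fun z : ℂ => Complex.exp ((t : ℂ) / z) * z ^ m) z := fun z hz =>
    ((differentiableAt_const _).div differentiableAt_id hz).cexp.mul
      (differentiableAt_zpow.2 (Or.inl hz))
  have hbound : ∀ R : ℝ, max ε 1 ≤ R →
      ‖∮ z in C(0, ε), Complex.exp ((t : ℂ) / z) * z ^ m‖ ≤ 2 * Real.pi * Real.exp |t| * R⁻¹ := by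
    intro R hR
    have hεR : ε ≤ R := (le_max_left _ _).trans hR
    have h1R : 1 ≤ R := (le_max_right _ _).trans hR
    have hR0 : 0 < R := by linarith
    rw [← Complex.circleIntegral_eq_of_differentiable_on_annulus_off_countable hε hεR
      Set.countable_empty]
    · refine (circleIntegral.norm_integral_le_of_norm_le_const (C := Real.exp |t| * R ^ (-2 : ℤ))
        hR0.le fun z hz => ?_).trans_eq ?_
      · have hz' : ‖z‖ = R := by simpa using hz
        rw [norm_mul, norm_zpow, hz']
        refine mul_le_mul ((norm_exp_ofReal_div_le hR0 le_rfl hz').trans ?_)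
          (zpow_le_zpow_right₀ h1R hm) (by positivity) (by positivity)
        exact Real.exp_le_exp.2 (div_le_self (abs_nonneg t) h1R)
      · rw [show (-2 : ℤ) = -1 + -1 by norm_num, zpow_add₀ hR0.ne', zpow_neg_one]
        field_simp
    · intro z hz
      refine (hdiff z ?_).continuousAt.continuousWithinAt
      rintro rfl
      simp [hε] at hz
    · intro z hz
      refine hdiff z ?_
      rintro rfl
      simp [hε.le] at hz
  have hlim : Filter.Tendsto (fun R : ℝ => 2 * Real.pi * Real.exp |t| * R⁻¹) Filter.atTop
      (nhds 0) := by
    simpa using tendsto_inv_atTop_zero.const_mul (2 * Real.pi * Real.exp |t|)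
  exact norm_le_zero_iff.1
    (ge_of_tendsto hlim ((Filter.eventually_ge_atTop (max ε 1)).mono hbound))

theorem circleIntegral_exp_div_mul_zpow_mul_prod_eq_zero {ι : Type*} {ε : ℝ} (hε : 0 < ε) (t : ℝ)
    (a : ι → ℂ) (S : Finset ι) : ∀ {m : ℤ}, m + S.card ≤ -2 →
    (∮ z in C(0, ε), Complex.exp ((t : ℂ) / z) * (z ^ m * ∏ i ∈ S, (1 - a i * z))) = 0 := by
  classical
  induction S using Finset.induction_on with
  | empty =>
    intro m hm
    simpa using circleIntegral_exp_div_mul_zpow_eq_zero hε t (m := m) (by simpa using hm)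
  | insert b S hb ih =>
    intro m hm
    rw [Finset.card_insert_of_notMem hb] at hm
    push_cast at hm
    have hint : ∀ n : ℤ, CircleIntegrable
        (fun z : ℂ => Complex.exp ((t : ℂ) / z) * (z ^ n * ∏ i ∈ S, (1 - a i * z))) 0 ε :=
      fun n => ContinuousOn.circleIntegrable hε.le <|
        (continuousOn_exp_div_sphere hε t).mul ((continuousOn_zpow_sphere hε n).mul
          (Continuous.continuousOn (by fun_prop)))
    -- Expanding one factor costs at most one power of `z`, which the smaller product compensates in
    -- the degree condition.
    have key : (∮ z in C(0, ε), Complex.exp ((t : ℂ) / z) *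
        (z ^ m * ∏ i ∈ insert b S, (1 - a i * z))) =
        ∮ z in C(0, ε), ((Complex.exp ((t : ℂ) / z) * (z ^ m * ∏ i ∈ S, (1 - a i * z))) -
          a b * (Complex.exp ((t : ℂ) / z) * (z ^ (m + 1) * ∏ i ∈ S, (1 - a i * z)))) := by
      refine circleIntegral.integral_congr hε.le fun z hz => ?_
      simp only [Finset.prod_insert hb, zpow_add_one₀ (ne_zero_of_mem_sphere_zero hε hz)]
      ring
    rw [key, circleIntegral.integral_sub (hint m)
      (by simpa using (hint (m + 1)).const_fun_smul (a := a b)), circleIntegral.integral_const_mul,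
      ih (by linarith), ih (by linarith)]
    simp

/-! ### The functions `F_{k,l}` -/

/-- The rational factor of the integrand of `tasepF`. -/
noncomputable def tasepWeight {N : ℕ} (v : Fin N → ℝ) (k l : ℕ) (z : ℂ) : ℂ :=
  (∏ i : Fin N with i.val + 1 < l, (1 - (v i : ℂ) * z)⁻¹) *
    ∏ i : Fin N with i.val + 1 < k, (1 - (v i : ℂ) * z)

theorem tasepF_eq_weight {N : ℕ} (v : Fin N → ℝ) (ε : ℝ) (k l : ℕ) (x : ℤ) (t : ℝ) :
    tasepF v ε k l x t = (2 * (Real.pi : ℂ) * Complex.I)⁻¹ * ∮ z in C(0, ε),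
      Complex.exp ((t : ℂ) / z) * (z ^ (x - 1) * tasepWeight v k l z) := by
  simp only [tasepF, tasepWeight, mul_assoc]

section

variable {N : ℕ} {v : Fin N → ℝ} {ε : ℝ} (hε : 0 < ε) (hv : ∀ i, 0 < v i) (hεv : ∀ i, ε * v i < 1)
include hε hv hεv

omit hε in
theorem one_sub_rate_mul_ne_zero (i : Fin N) {z : ℂ} (hz : ‖z‖ ≤ ε) : 1 - (v i : ℂ) * z ≠ 0 := by
  intro h
  have h1 : ‖(v i : ℂ) * z‖ = 1 := by rw [← sub_eq_zero.1 h]; simp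
  rw [norm_mul, Complex.norm_real, Real.norm_of_nonneg (hv i).le] at h1
  have := mul_le_mul_of_nonneg_left hz (hv i).le
  have := hεv i
  nlinarith

omit hε in
theorem differentiableAt_tasepWeight (k l : ℕ) {z : ℂ} (hz : ‖z‖ ≤ ε) :
    DifferentiableAt ℂ (tasepWeight v k l) z := by
  unfold tasepWeight
  refine DifferentiableAt.mul (DifferentiableAt.fun_finsetProd fun i _ => ?_)
    (DifferentiableAt.fun_finsetProd fun i _ => by fun_prop)
  exact DifferentiableAt.fun_inv (by fun_prop) (one_sub_rate_mul_ne_zero hv hεv i hz)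

omit hε in
theorem continuousOn_tasepWeight (k l : ℕ) :
    ContinuousOn (tasepWeight v k l) (Metric.sphere 0 ε) := fun z hz =>
  (differentiableAt_tasepWeight hv hεv k l
    (by simpa using (mem_sphere_zero_iff_norm.1 hz).le)).continuousAt.continuousWithinAt

theorem continuousOn_tasepF_integrand (k l : ℕ) (x : ℤ) (t : ℝ) :
    ContinuousOn (fun z : ℂ => Complex.exp ((t : ℂ) / z) * (z ^ (x - 1) * tasepWeight v k l z))
      (Metric.sphere 0 ε) :=
  (continuousOn_exp_div_sphere hε t).mul
    ((continuousOn_zpow_sphere hε _).mul (continuousOn_tasepWeight hv hεv k l))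

theorem hasDerivAt_tasepF (k l : ℕ) (x : ℤ) (t : ℝ) :
    HasDerivAt (tasepF v ε k l x) (tasepF v ε k l (x - 1) t) t := by
  have h := (hasDerivAt_circleIntegral_exp_div hε ((continuousOn_zpow_sphere hε (x - 1)).mul
    (continuousOn_tasepWeight hv hεv k l)) t).const_mul (2 * (Real.pi : ℂ) * Complex.I)⁻¹
  have hfun : tasepF v ε k l x = _ := funext fun s => tasepF_eq_weight v ε k l x s
  rw [hfun, tasepF_eq_weight]
  refine h.congr_deriv (congrArg _ (circleIntegral.integral_congr hε.le fun z hz => ?_))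
  simp only [zpow_sub_one₀ (ne_zero_of_mem_sphere_zero hε hz), Pi.mul_apply]
  ring

/-- On the integrand, the left side multiplies by `1 - v k * z`, the factor that separates
consecutive values of the first index. -/
theorem tasepF_sub_rate_mul (k : Fin N) (l : ℕ) (x : ℤ) (t : ℝ) :
    tasepF v ε (k + 1) l (x - 1) t - v k * tasepF v ε (k + 1) l x t =
      tasepF v ε (k + 2) l (x - 1) t := by
  have hint : ∀ x : ℤ, CircleIntegrable (fun z : ℂ => Complex.exp ((t : ℂ) / z) *
      (z ^ (x - 1) * tasepWeight v (k + 1) l z)) 0 ε := fun x =>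
    (continuousOn_tasepF_integrand hε hv hεv _ l x t).circleIntegrable hε.le
  simp only [tasepF_eq_weight]
  rw [mul_left_comm, ← mul_sub, ← circleIntegral.integral_const_mul, ← circleIntegral.integral_sub
    (hint _) (by simpa using (hint x).const_fun_smul (a := (v k : ℂ)))]
  refine congrArg _ (circleIntegral.integral_congr hε.le fun z hz => ?_)
  have hz0 := ne_zero_of_mem_sphere_zero hε hz
  have hfilter : Finset.univ.filter (fun i : Fin N => i.val + 1 < (k : ℕ) + 2) =
      insert k (Finset.univ.filter fun i : Fin N => i.val + 1 < (k : ℕ) + 1) := by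
    ext i
    simp only [Finset.mem_filter, Finset.mem_univ, true_and, Finset.mem_insert, Fin.ext_iff]
    omega
  simp only [tasepWeight, hfilter]
  rw [Finset.prod_insert (by simp)]
  have : z ^ (x - 1) = z ^ (x - 1 - 1) * z := by rw [← zpow_add_one₀ hz0, sub_add_cancel]
  rw [this]
  ring

theorem exists_norm_tasepF_le (k l : ℕ) (T : ℝ) :
    ∃ C, 0 ≤ C ∧ ∀ (x : ℤ) (t : ℝ), |t| ≤ T → ‖tasepF v ε k l x t‖ ≤ C * ε ^ x := by
  obtain ⟨M, hM⟩ := (isCompact_sphere (0 : ℂ) ε).exists_bound_of_continuousOn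
    (continuousOn_tasepWeight hv hεv k l)
  have hM0 : 0 ≤ M := (norm_nonneg _).trans (hM (circleMap 0 ε 0) (circleMap_mem_sphere 0 hε.le 0))
  refine ⟨Real.exp (T / ε) * M, by positivity, fun x t ht => ?_⟩
  rw [tasepF_eq_weight]
  refine (norm_mul_le _ _).trans ?_
  have hI : ‖(2 * (Real.pi : ℂ) * Complex.I)⁻¹‖ = (2 * Real.pi)⁻¹ := by
    simp [abs_of_pos Real.pi_pos]
  rw [hI]
  refine (mul_le_mul_of_nonneg_left (circleIntegral.norm_integral_le_of_norm_le_const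
    (C := Real.exp (T / ε) * (ε ^ (x - 1) * M)) hε.le fun z hz => ?_)
    (by positivity)).trans_eq ?_
  · have hz' : ‖z‖ = ε := by simpa using hz
    rw [norm_mul, norm_mul, norm_zpow, hz']
    gcongr
    · exact norm_exp_ofReal_div_le hε ht hz'
    · exact hM z hz
  · rw [zpow_sub_one₀ hε.ne']
    field_simp

/-- All the denominators cancel, leaving a polynomial of degree `N - 1 - l`; the bound on `x` then
makes the integrand `O(z⁻²)` at infinity. -/
theorem tasepF_last_row_eq_zero (l : Fin N) {x : ℤ} (hx : x ≤ (l : ℤ) - N) (t : ℝ) :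
    tasepF v ε (N + 1) (l + 2) x t = 0 := by
  rw [tasepF_eq_weight]
  have key : (∮ z in C(0, ε), Complex.exp ((t : ℂ) / z) *
      (z ^ (x - 1) * tasepWeight v (N + 1) (l + 2) z)) =
      ∮ z in C(0, ε), Complex.exp ((t : ℂ) / z) *
        (z ^ (x - 1) * ∏ i ∈ Finset.Ioi l, (1 - (v i : ℂ) * z)) := by
    refine circleIntegral.integral_congr hε.le fun z hz => ?_
    have hz' : ‖z‖ ≤ ε := (mem_sphere_zero_iff_norm.1 hz).le
    have h1 : Finset.univ.filter (fun i : Fin N => i.val + 1 < N + 1) = Finset.univ := by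
      ext i; simp
    have h2 : Finset.univ.filter (fun i : Fin N => ¬ i.val + 1 < (l : ℕ) + 2) = Finset.Ioi l := by
      ext i
      rw [Finset.mem_filter, Finset.mem_Ioi, Fin.lt_def]
      simp only [Finset.mem_univ, true_and]
      omega
    simp only [tasepWeight, h1]
    rw [← Finset.prod_filter_mul_prod_filter_not Finset.univ
      (fun i : Fin N => i.val + 1 < (l : ℕ) + 2) (fun i => 1 - (v i : ℂ) * z), h2, ← mul_assoc
      (∏ i : Fin N with i.val + 1 < (l : ℕ) + 2, (1 - (v i : ℂ) * z)⁻¹), ← Finset.prod_mul_distrib,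
      Finset.prod_congr rfl fun i _ =>
        inv_mul_cancel₀ (one_sub_rate_mul_ne_zero hv hεv i hz'), Finset.prod_const_one, one_mul]
  rw [key, circleIntegral_exp_div_mul_zpow_mul_prod_eq_zero hε t (fun i => (v i : ℂ)), mul_zero]
  rw [Fin.card_Ioi]
  have := l.isLt
  omega

theorem tasepF_zero_time_eq_zero (k l : ℕ) {x : ℤ} (hx : 1 ≤ x) : tasepF v ε k l x 0 = 0 := by
  rw [tasepF_eq_weight]
  obtain ⟨n, hn⟩ := Int.eq_ofNat_of_zero_le (sub_nonneg.2 hx)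
  have hd : ∀ z : ℂ, ‖z‖ ≤ ε → DifferentiableAt ℂ (fun z : ℂ =>
      Complex.exp (((0 : ℝ) : ℂ) / z) * (z ^ (x - 1) * tasepWeight v k l z)) z := fun z hz => by
    simp only [hn, zpow_natCast, Complex.ofReal_zero, zero_div, Complex.exp_zero, one_mul]
    exact (differentiableAt_id.pow n).mul (differentiableAt_tasepWeight hv hεv k l hz)
  rw [Complex.circleIntegral_eq_zero_of_differentiable_on_off_countable hε.le Set.countable_empty,
    mul_zero]
  · exact fun z hz => (hd z (by simpa using hz)).continuousAt.continuousWithinAt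
  · exact fun z hz => hd z (mem_ball_zero_iff.1 hz.1).le

theorem tasepF_zero_time_eq_one (k l : ℕ) : tasepF v ε k l 0 0 = 1 := by
  rw [tasepF_eq_weight]
  have h := Complex.circleIntegral_sub_inv_smul_of_differentiable_on_off_countable
    (c := 0) (w := 0) (R := ε) (f := tasepWeight v k l) Set.countable_empty (by simpa using hε)
    (fun z hz => (differentiableAt_tasepWeight hv hεv k l
      (by simpa using hz)).continuousAt.continuousWithinAt)
    (fun z hz => differentiableAt_tasepWeight hv hεv k l (mem_ball_zero_iff.1 hz.1).le)
  simp only [sub_zero, smul_eq_mul] at h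
  simp only [Complex.ofReal_zero, zero_div, Complex.exp_zero, one_mul, zero_sub, zpow_neg_one, h]
  have : tasepWeight v k l 0 = 1 := by simp [tasepWeight]
  rw [this, mul_one]
  exact inv_mul_cancel₀ (by simp [Real.pi_ne_zero])

end

/-! ### The determinant as a solution of the backward equation -/

theorem Matrix.hasDerivAt_det {n : Type*} [Fintype n] [DecidableEq n] {M : ℝ → Matrix n n ℂ}
    {M' : Matrix n n ℂ} {t : ℝ} (h : ∀ i j, HasDerivAt (fun s => M s i j) (M' i j) t) :
    HasDerivAt (fun s => (M s).det) (∑ k, ((M t).updateRow k (M' k)).det) t := by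
  simp only [Matrix.det_apply']
  rw [Finset.sum_comm]
  refine HasDerivAt.fun_sum fun σ _ => ?_
  refine ((HasDerivAt.fun_finsetProd fun i _ => h (σ i) i).const_mul _).congr_deriv ?_
  rw [Finset.mul_sum, ← Equiv.sum_comp σ fun k => (Equiv.Perm.sign σ : ℂ) *
    ∏ i, (M t).updateRow k (M' k) (σ i) i]
  refine Finset.sum_congr rfl fun i _ => congrArg _ ?_
  rw [← Finset.prod_erase_mul _ _ (Finset.mem_univ i), Matrix.updateRow_self, smul_eq_mul]
  refine congrArg (· * _) (Finset.prod_congr rfl fun j hj => ?_)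
  rw [Matrix.updateRow_ne (σ.injective.ne (Finset.ne_of_mem_erase hj))]

/-- The function `F_{k,l}` with its exponential prefactor, for a particle `k` at the site `a`. -/
noncomputable def tasepEntry {N : ℕ} (v : Fin N → ℝ) (ε : ℝ) (x : ℤ) (k l : Fin N) (a : ℤ)
    (t : ℝ) : ℂ :=
  Complex.exp (-(t : ℂ) * (v k : ℂ)) * (v k : ℂ) ^ (x + k - a) *
    tasepF v ε ((k : ℕ) + 1) ((l : ℕ) + 2) (x - a + l) t

/-- The probability that particles started from `y` are all to the right of `x` at time `t`, as long
as particle `k` (counted from `0`) starts at or to the left of `x + k`. -/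
noncomputable def tasepDet {N : ℕ} (v : Fin N → ℝ) (ε : ℝ) (x : ℤ) (y : Fin N → ℤ) (t : ℝ) : ℂ :=
  (Matrix.of fun k l => tasepEntry v ε x k l (y k) t).det

/-- Particle `k` no longer influences whether particle `0` reaches `x` once it has reached
`x + k`. -/
noncomputable def tasepProb {N : ℕ} (v : Fin N → ℝ) (ε : ℝ) (x : ℤ) (y : Fin N → ℤ) (t : ℝ) : ℂ :=
  tasepDet v ε x (fun k => min (y k) (x + k)) t

theorem tasepQ_eq_tasepDet {N : ℕ} (v : Fin N → ℝ) (ε : ℝ) (x : ℤ) (t : ℝ) :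
    tasepQ v ε x t = tasepDet v ε x (blockConfig N) t := by
  rw [tasepQ, ← Matrix.det_mul_column, tasepDet]
  congr 1
  ext k l
  simp only [Matrix.of_apply, tasepEntry, blockConfig]
  congr 2
  · congr 1; ring
  · ring

theorem tasepDet_update {N : ℕ} (v : Fin N → ℝ) (ε : ℝ) (x : ℤ) (y : Fin N → ℤ) (t : ℝ)
    (k : Fin N) (a : ℤ) :
    tasepDet v ε x (Function.update y k a) t =
      ((Matrix.of fun k l => tasepEntry v ε x k l (y k) t).updateRow k
        fun l => tasepEntry v ε x k l a t).det := by
  rw [tasepDet]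
  congr 1
  ext i j
  by_cases h : i = k
  · subst h; simp
  · simp [h]

section

variable {N : ℕ} {v : Fin N → ℝ} {ε : ℝ} (hε : 0 < ε) (hv : ∀ i, 0 < v i) (hεv : ∀ i, ε * v i < 1)
include hε hv hεv

theorem hasDerivAt_tasepEntry (x : ℤ) (k l : Fin N) (a : ℤ) (t : ℝ) :
    HasDerivAt (tasepEntry v ε x k l a)
      (v k * (tasepEntry v ε x k l (a + 1) t - tasepEntry v ε x k l a t)) t := by
  have hvk : (v k : ℂ) ≠ 0 := by exact_mod_cast (hv k).ne'
  have h1 : HasDerivAt (fun s : ℝ => Complex.exp (-(s : ℂ) * (v k : ℂ)))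
      (Complex.exp (-(t : ℂ) * (v k : ℂ)) * -(v k : ℂ)) t := by
    simpa using ((Complex.ofRealCLM.hasDerivAt (x := t)).neg.mul_const (v k : ℂ)).cexp
  refine ((h1.mul_const ((v k : ℂ) ^ (x + k - a))).mul
    (hasDerivAt_tasepF hε hv hεv _ _ (x - a + l) t)).congr_deriv ?_
  simp only [tasepEntry]
  rw [show x + k - (a + 1) = x + k - a - 1 by ring, show x - (a + 1) + (l : ℤ) = x - a + l - 1 by ring,
    zpow_sub_one₀ hvk]
  field_simp
  ring

/-- The increment involves the `F` of the next row. Both boundary conditions, at a blocked particle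
and at the last one, rest on this. -/
theorem tasepEntry_add_one (x : ℤ) (k : Fin N) (a : ℤ) (t : ℝ) (l : Fin N) :
    tasepEntry v ε x k l (a + 1) t = tasepEntry v ε x k l a t +
      Complex.exp (-(t : ℂ) * (v k : ℂ)) * (v k : ℂ) ^ (x + k - a - 1) *
        tasepF v ε ((k : ℕ) + 2) ((l : ℕ) + 2) (x - a + l - 1) t := by
  have hvk : (v k : ℂ) ≠ 0 := by exact_mod_cast (hv k).ne'
  simp only [tasepEntry]
  rw [← tasepF_sub_rate_mul hε hv hεv, show x + k - (a + 1) = x + k - a - 1 by ring,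
    show x - (a + 1) + (l : ℤ) = x - a + l - 1 by ring, zpow_sub_one₀ hvk]
  field_simp
  ring

theorem hasDerivAt_tasepDet (x : ℤ) (y : Fin N → ℤ) (t : ℝ) :
    HasDerivAt (tasepDet v ε x y)
      (∑ k, (v k : ℂ) *
        (tasepDet v ε x (Function.update y k (y k + 1)) t - tasepDet v ε x y t)) t := by
  refine (Matrix.hasDerivAt_det (M := fun t => Matrix.of fun k l => tasepEntry v ε x k l (y k) t)
    (M' := Matrix.of fun k l => (v k : ℂ) *
      (tasepEntry v ε x k l (y k + 1) t - tasepEntry v ε x k l (y k) t))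
    fun k l => hasDerivAt_tasepEntry hε hv hεv x k l (y k) t).congr_deriv ?_
  refine Finset.sum_congr rfl fun k _ => ?_
  rw [tasepDet_update]
  set M := Matrix.of fun k l => tasepEntry v ε x k l (y k) t
  have hrow : (Matrix.of fun k l => (v k : ℂ) *
      (tasepEntry v ε x k l (y k + 1) t - tasepEntry v ε x k l (y k) t)) k =
      (v k : ℂ) • ((fun l => tasepEntry v ε x k l (y k + 1) t) + (-1 : ℂ) • M k) := by
    ext l
    simp only [M, Matrix.of_apply, Pi.smul_apply, Pi.add_apply, smul_eq_mul]
    ring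
  rw [hrow, Matrix.det_updateRow_smul, Matrix.det_updateRow_add, Matrix.det_updateRow_smul,
    Matrix.updateRow_eq_self, neg_one_mul, ← sub_eq_add_neg]
  rfl

theorem tasepDet_update_of_blocked (x : ℤ) (y : Fin N → ℤ) (t : ℝ) {k j : Fin N}
    (hj : (j : ℕ) = k + 1) (hy : y j = y k + 1) :
    tasepDet v ε x (Function.update y k (y k + 1)) t = tasepDet v ε x y t := by
  have hvj : (v j : ℂ) ≠ 0 := by exact_mod_cast (hv j).ne'
  have hkj : k ≠ j := by rintro rfl; omega
  rw [tasepDet_update]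
  set M := Matrix.of fun k l => tasepEntry v ε x k l (y k) t with hM
  -- The ratio of the prefactor of the increment of row `k` to that of row `j`; the `F` factors
  -- agree because the particles are adjacent.
  set c : ℂ := Complex.exp (-(t : ℂ) * (v k : ℂ)) * (v k : ℂ) ^ (x + k - y k - 1) *
    (Complex.exp (-(t : ℂ) * (v j : ℂ)) * (v j : ℂ) ^ (x + j - y j))⁻¹ with hc
  have hrow : (fun l => tasepEntry v ε x k l (y k + 1) t) = M k + c • M j := by
    ext l
    simp only [tasepEntry_add_one hε hv hεv, hM, Pi.add_apply, Pi.smul_apply, Matrix.of_apply,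
      smul_eq_mul, add_right_inj]
    rw [tasepEntry, hc, hj, show x - y j + (l : ℤ) = x - y k + l - 1 by rw [hy]; ring]
    have h1 := Complex.exp_ne_zero (-(t : ℂ) * (v j : ℂ))
    have h2 := zpow_ne_zero (x + j - y j) hvj
    field_simp
  rw [hrow, Matrix.det_updateRow_add_smul_self M hkj, tasepDet]

theorem tasepDet_update_of_last (x : ℤ) (y : Fin N → ℤ) (t : ℝ) {k : Fin N}
    (hk : (k : ℕ) + 1 = N) (hy : x + k ≤ y k) :
    tasepDet v ε x (Function.update y k (y k + 1)) t = tasepDet v ε x y t := by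
  rw [tasepDet_update]
  set M := Matrix.of fun k l => tasepEntry v ε x k l (y k) t with hM
  have hrow : (fun l => tasepEntry v ε x k l (y k + 1) t) = M k := by
    ext l
    rw [tasepEntry_add_one hε hv hεv, show (k : ℕ) + 2 = N + 1 by omega,
      tasepF_last_row_eq_zero hε hv hεv l (by omega), mul_zero, add_zero]
    rfl
  rw [hrow, Matrix.updateRow_eq_self, tasepDet]

/-- Needed when `x` lies to the left of the initial block, where the truncation is active. -/
theorem tasepDet_add_natCast (x : ℤ) (t : ℝ) (m : ℕ) :
    tasepDet v ε x (fun k => x + k + m) t = tasepDet v ε x (fun k => x + k) t := by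
  induction m with
  | zero => simp
  | succ m ih =>
    rw [← ih]
    -- The staircase is shifted one particle at a time from the left, so that each moved particle
    -- has an adjacent right neighbour, except the last, which is beyond its cap.
    let z : ℕ → Fin N → ℤ := fun p k => x + k + m + if (k : ℕ) < p then 1 else 0
    have hstep : ∀ p ≤ N, tasepDet v ε x (z p) t = tasepDet v ε x (z 0) t := by
      intro p
      induction p with
      | zero => exact fun _ => rfl
      | succ p ihp =>
        intro hp
        let k : Fin N := ⟨p, hp⟩
        rw [← ihp (by omega)]
        have hz : z (p + 1) = Function.update (z p) k (z p k + 1) := by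
          ext i
          by_cases hi : i = k
          · subst hi; simp [z, k]
          · have : (i : ℕ) ≠ p := fun h => hi (Fin.ext h)
            have h2 : (i : ℕ) < p + 1 ↔ (i : ℕ) < p := by omega
            simp [z, hi, h2]
        rw [hz]
        by_cases hpN : p + 1 = N
        · exact tasepDet_update_of_last hε hv hεv x _ t hpN (by simp [z, k])
        · refine tasepDet_update_of_blocked hε hv hεv x _ t (j := ⟨p + 1, by omega⟩) rfl ?_
          simp [z, k]
          ring
    have h0 : z 0 = fun k : Fin N => x + k + m := by ext k; simp [z]
    have hN : z N = fun k : Fin N => x + k + (m + 1 : ℕ) := by ext k; simp [z]; ring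
    rw [← h0, ← hN]
    exact hstep N le_rfl

theorem tasepQ_eq_tasepProb (x : ℤ) (t : ℝ) :
    tasepQ v ε x t = tasepProb v ε x (blockConfig N) t := by
  rw [tasepQ_eq_tasepDet, tasepProb]
  rcases le_total (1 - (N : ℤ)) x with h | h
  · congr 1
    ext k
    exact (min_eq_left (by simp only [blockConfig]; omega)).symm
  · obtain ⟨m, hm⟩ := Int.eq_ofNat_of_zero_le (sub_nonneg.2 h)
    have h1 : blockConfig N = fun k : Fin N => x + k + m := by
      ext k
      simp only [blockConfig]
      omega
    have h2 : (fun k => min (blockConfig N k) (x + k)) = fun k : Fin N => x + (k : ℤ) :=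
      funext fun k => min_eq_right (by simp only [h1]; omega)
    rw [h2, h1, tasepDet_add_natCast hε hv hεv]

/-- The argument of `F` in entry `(k, l)` is `l - k`: no pole above the diagonal, a simple pole of
residue `1` on it. -/
theorem tasepDet_zero_time_eq_one (x : ℤ) : tasepDet v ε x (fun k => x + k) 0 = 1 := by
  rw [tasepDet, Matrix.det_of_isLowerTriangular]
  · refine Finset.prod_eq_one fun k _ => ?_
    simp [tasepEntry, tasepF_zero_time_eq_one hε hv hεv]
  · intro k l hkl
    have hkl' : (k : ℕ) < l := hkl
    rw [Matrix.of_apply, tasepEntry, tasepF_zero_time_eq_zero hε hv hεv _ _ (by omega), mul_zero]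

theorem tasepDet_zero_time_eq_zero (x : ℤ) {y : Fin N → ℤ} {k : Fin N} (hy : y k < x) :
    tasepDet v ε x y 0 = 0 := by
  refine Matrix.det_eq_zero_of_row_eq_zero k fun l => ?_
  rw [Matrix.of_apply, tasepEntry, tasepF_zero_time_eq_zero hε hv hεv _ _ (by omega), mul_zero]

/-- With `n = x + k - a ≥ 0`, the prefactor grows like `v k ^ n` and the contour integral like `ε ^
n`; the product is bounded because `ε * v k < 1`. -/
theorem exists_norm_tasepEntry_le (x : ℤ) (T : ℝ) (k l : Fin N) :
    ∃ C, 0 ≤ C ∧ ∀ (a : ℤ) (t : ℝ), a ≤ x + k → t ∈ Set.Icc 0 T →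
      ‖tasepEntry v ε x k l a t‖ ≤ C := by
  obtain ⟨C, hC0, hC⟩ := exists_norm_tasepF_le hε hv hεv (k + 1) (l + 2) T
  refine ⟨C * ε ^ ((l : ℤ) - k), by positivity, fun a t ha ht => ?_⟩
  obtain ⟨n, hn⟩ := Int.eq_ofNat_of_zero_le (sub_nonneg.2 ha)
  have h1 : ‖Complex.exp (-(t : ℂ) * (v k : ℂ))‖ ≤ 1 := by
    rw [Complex.norm_exp, Real.exp_le_one_iff]
    have := mul_nonneg ht.1 (hv k).le
    simpa using this
  have h2 : ‖(v k : ℂ) ^ (x + k - a)‖ = v k ^ n := by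
    rw [hn, norm_zpow, Complex.norm_real, Real.norm_of_nonneg (hv k).le]
    exact zpow_natCast _ _
  have h3 : ε ^ (x - a + l) = ε ^ n * ε ^ ((l : ℤ) - k) := by
    rw [← zpow_natCast ε n, ← zpow_add₀ hε.ne']
    congr 1
    have : x + k - a = (n : ℤ) := hn
    linarith
  rw [tasepEntry, norm_mul, norm_mul, h2]
  calc ‖Complex.exp (-(t : ℂ) * (v k : ℂ))‖ * v k ^ n *
        ‖tasepF v ε (k + 1) (l + 2) (x - a + l) t‖
      ≤ 1 * v k ^ n * (C * ε ^ (x - a + l)) := by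
        have := (hv k).le
        gcongr
        exact hC _ _ (by rw [abs_of_nonneg ht.1]; exact ht.2)
    _ = (ε * v k) ^ n * (C * ε ^ ((l : ℤ) - k)) := by rw [h3, mul_pow]; ring
    _ ≤ 1 * (C * ε ^ ((l : ℤ) - k)) := by
        gcongr
        exact pow_le_one₀ (mul_nonneg hε.le (hv k).le) (hεv k).le
    _ = _ := one_mul _

theorem exists_norm_tasepProb_le (x : ℤ) (T : ℝ) :
    ∃ C, ∀ (y : Fin N → ℤ) (t : ℝ), t ∈ Set.Icc 0 T → ‖tasepProb v ε x y t‖ ≤ C := by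
  choose C hC0 hC using exists_norm_tasepEntry_le hε hv hεv x T
  refine ⟨_, fun y t ht => Matrix.det_le (abv := NormedField.toAbsoluteValue ℂ)
    (x := ∑ k, ∑ l, C k l) fun k l => ?_⟩
  refine (hC k l _ t (min_le_right _ _) ht).trans ?_
  exact (Finset.single_le_sum (fun l _ => hC0 k l) (Finset.mem_univ l)).trans
    (Finset.single_le_sum (f := fun k => ∑ l, C k l)
      (fun k _ => Finset.sum_nonneg fun l _ => hC0 k l) (Finset.mem_univ k))

theorem tasepProb_zero_time (x : ℤ) {y : Fin N → ℤ} (hy : StrictMono y) :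
    tasepProb v ε x y 0 = if ∀ k, x ≤ y k then 1 else 0 := by
  split_ifs with h
  · have hle : ∀ k : Fin N, x + k ≤ y k := by
      rintro ⟨n, hn⟩
      induction n with
      | zero => simpa using h ⟨0, hn⟩
      | succ n ih =>
        have h1 := ih (by omega)
        have h2 : y ⟨n, by omega⟩ < y ⟨n + 1, hn⟩ := hy (by simp [Fin.lt_def])
        push_cast at h1 ⊢
        omega
    have : (fun k : Fin N => min (y k) (x + k)) = fun k : Fin N => x + (k : ℤ) :=
      funext fun k => min_eq_right (hle k)
    rw [tasepProb, this, tasepDet_zero_time_eq_one hε hv hεv]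
  · push Not at h
    obtain ⟨k, hk⟩ := h
    exact tasepDet_zero_time_eq_zero hε hv hεv x (k := k) ((min_le_left _ _).trans_lt hk)

/-- In either case, unless `k` is last, the truncated positions of `k` and `k + 1` are adjacent. If
`k` is last, nothing can block it, so it is at its cap. -/
theorem tasepProb_blocked (x : ℤ) {y : Fin N → ℤ} (hy : StrictMono y) (t : ℝ) {k : Fin N}
    (hk : x + k ≤ y k ∨ ∃ j, y j = y k + 1) :
    tasepDet v ε x (Function.update (fun k => min (y k) (x + k)) k (min (y k) (x + k) + 1)) t =
      tasepProb v ε x y t := by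
  set z : Fin N → ℤ := fun k => min (y k) (x + k) with hz
  have hzk : z k = min (y k) (x + k) := rfl
  rw [← hzk, tasepProb]
  by_cases hN : (k : ℕ) + 1 = N
  · refine tasepDet_update_of_last hε hv hεv x z t hN ?_
    rcases hk with hk | ⟨j, hj⟩
    · exact (min_eq_right hk).ge
    · have hlt : k < j := hy.lt_iff_lt.1 (by omega)
      have h1 : (k : ℕ) < j := hlt
      omega
  · let j : Fin N := ⟨k + 1, by omega⟩
    have hkj : k < j := by simp [j, Fin.lt_def]
    have hyj : y k + 1 ≤ y j := hy hkj
    refine tasepDet_update_of_blocked hε hv hεv x z t (j := j) rfl ?_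
    have hzj : z j = min (y j) (x + (k + 1)) := by simp [hz, j]
    rw [hzk, hzj]
    rcases hk with hk | ⟨i, hi⟩
    · omega
    · have hki : k < i := hy.lt_iff_lt.1 (by omega)
      have hji : j ≤ i := by
        have h1 : (k : ℕ) < i := hki
        exact Fin.le_def.2 (by simpa [j] using h1)
      have := hy.monotone hji
      omega

/-- The functional `φ` stands for the real or imaginary part, since test functions are real-valued.
-/
theorem hasDerivAt_tasepProb (φ : ℂ →L[ℝ] ℝ) (x : ℤ) {y : Fin N → ℤ} (hy : StrictMono y) (t : ℝ) :
    HasDerivAt (fun t => φ (tasepProb v ε x y t))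
      (tasepGenerator v (fun y => φ (tasepProb v ε x y t)) y) t := by
  refine (φ.hasFDerivAt.comp_hasDerivAt t (hasDerivAt_tasepDet hε hv hεv x
    (fun k => min (y k) (x + k)) t)).congr_deriv ?_
  rw [map_sum, tasepGenerator, tsum_fintype]
  refine Finset.sum_congr rfl fun k _ => ?_
  rw [← Complex.real_smul, map_smul, map_sub, smul_eq_mul]
  split_ifs with h
  · congr 3
    -- At its cap the particle hops without effect on either side; below it, truncation commutes
    -- with the hop.
    by_cases hk : x + k ≤ y k
    · rw [tasepProb_blocked hε hv hεv x hy t (Or.inl hk), tasepProb, tasepProb]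
      congr 1
      ext i
      by_cases hi : i = k
      · subst hi; simp; omega
      · simp [hi]
    · rw [tasepProb]
      congr 1
      ext i
      by_cases hi : i = k
      · subst hi; simp; omega
      · simp [hi]
  · push Not at h
    rw [tasepProb_blocked hε hv hεv x hy t (Or.inr h), tasepProb, sub_self, mul_zero]

end

instance isFiniteMeasure_restrict_uIoc (a b : ℝ) :
    IsFiniteMeasure (volume.restrict (Set.uIoc a b)) :=
  inferInstanceAs (IsFiniteMeasure (volume.restrict (Set.Ioc _ _)))

/-! ### The generator and the martingale problem for finitely many particles -/

/-- Over `n + 1` equal steps the errors add up to `K * T ^ 2 / (n + 1)`. -/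
theorem eq_of_abs_sub_le_sq {g : ℝ → ℝ} {T K : ℝ} (hT : 0 ≤ T)
    (h : ∀ a b, 0 ≤ a → a ≤ b → b ≤ T → |g b - g a| ≤ K * (b - a) ^ 2) : g T = g 0 := by
  have hn : ∀ n : ℕ, |g T - g 0| ≤ K * T ^ 2 * (1 / ((n : ℝ) + 1)) := by
    intro n
    have hn0 : (0 : ℝ) < n + 1 := by positivity
    have hle : ∀ i : ℕ, i ≤ n + 1 → (i : ℝ) * (T / (n + 1)) ≤ T := fun i hi => by
      have : (i : ℝ) ≤ n + 1 := by exact_mod_cast hi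
      calc (i : ℝ) * (T / (n + 1)) ≤ (n + 1) * (T / (n + 1)) := by gcongr
        _ = T := by field_simp
    have hsum := Finset.sum_range_sub (fun i : ℕ => g (i * (T / (n + 1)))) (n + 1)
    have hend : ((n + 1 : ℕ) : ℝ) * (T / (n + 1)) = T := by push_cast; field_simp
    simp only [hend, Nat.cast_zero, zero_mul] at hsum
    rw [← hsum]
    refine (Finset.abs_sum_le_sum_abs _ _).trans ((Finset.sum_le_card_nsmul _ _
      (K * (T / (n + 1)) ^ 2) fun i hi => ?_).trans_eq ?_)
    · have hi' : i + 1 ≤ n + 1 := Finset.mem_range.1 hi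
      refine (h _ _ (by positivity) ?_ (hle _ hi')).trans_eq ?_
      · push_cast
        gcongr
        linarith
      · push_cast
        ring
    · simp only [Finset.card_range, nsmul_eq_mul]
      push_cast
      field_simp
  have hlim : Filter.Tendsto (fun n : ℕ => K * T ^ 2 * (1 / ((n : ℝ) + 1))) Filter.atTop
      (nhds 0) := by
    simpa using (tendsto_one_div_add_atTop_nhds_zero_nat (𝕜 := ℝ)).const_mul (K * T ^ 2)
  have h0 : |g T - g 0| ≤ 0 := ge_of_tendsto' hlim hn
  exact sub_eq_zero.1 (abs_eq_zero.1 (le_antisymm h0 (abs_nonneg _)))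

theorem StrictMono.update_add_one {ι : Type*} [LinearOrder ι] {y : ι → ℤ} (hy : StrictMono y)
    {j : ι} (hj : ∀ k, y k ≠ y j + 1) : StrictMono (Function.update y j (y j + 1)) := by
  intro a b hab
  have h := hy hab
  by_cases ha : a = j
  · subst ha
    have := hj b
    simp only [Function.update_self, Function.update_of_ne hab.ne']
    omega
  · by_cases hb : b = j
    · subst hb
      simp only [Function.update_self, Function.update_of_ne ha]
      omega
    · simpa [ha, hb] using h

section

variable {N : ℕ} {v : Fin N → ℝ}

theorem tasepGenerator_eq_sum (f : (Fin N → ℤ) → ℝ) (y : Fin N → ℤ) :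
    tasepGenerator v f y = ∑ j, if ∀ k, y k ≠ y j + 1 then
      v j * (f (Function.update y j (y j + 1)) - f y) else 0 := by
  rw [tasepGenerator, tsum_fintype]
  refine Finset.sum_congr rfl fun j _ => ?_
  congr!

theorem tasepGenerator_sub (f g : (Fin N → ℤ) → ℝ) (y : Fin N → ℤ) :
    tasepGenerator v (fun y => f y - g y) y = tasepGenerator v f y - tasepGenerator v g y := by
  simp only [tasepGenerator_eq_sum]
  rw [← Finset.sum_sub_distrib]
  refine Finset.sum_congr rfl fun j _ => ?_
  split_ifs <;> ring

theorem abs_tasepGenerator_le (hv : ∀ i, 0 < v i) {f : (Fin N → ℤ) → ℝ} {C : ℝ} {y : Fin N → ℤ}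
    (hC : |f y| ≤ C)
    (h : ∀ j, (∀ k, y k ≠ y j + 1) → |f (Function.update y j (y j + 1))| ≤ C) :
    |tasepGenerator v f y| ≤ 2 * (∑ i, v i) * C := by
  have hC0 : 0 ≤ C := (abs_nonneg _).trans hC
  rw [tasepGenerator_eq_sum]
  refine (Finset.abs_sum_le_sum_abs _ _).trans ?_
  rw [Finset.mul_sum, Finset.sum_mul]
  refine Finset.sum_le_sum fun j _ => ?_
  have hvj := hv j
  split_ifs with hj
  · rw [abs_mul, abs_of_pos hvj]
    have : |f (Function.update y j (y j + 1)) - f y| ≤ C + C :=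
      (abs_sub _ _).trans (add_le_add (h j hj) hC)
    calc _ ≤ v j * (C + C) := mul_le_mul_of_nonneg_left this hvj.le
      _ = _ := by ring
  · rw [abs_zero]
    positivity

theorem abs_tasepGenerator_le_of_bounded (hv : ∀ i, 0 < v i) {f : (Fin N → ℤ) → ℝ} {C : ℝ}
    (hC : ∀ y, |f y| ≤ C) (y : Fin N → ℤ) : |tasepGenerator v f y| ≤ 2 * (∑ i, v i) * C :=
  abs_tasepGenerator_le hv (hC y) fun _ _ => hC _

end

/-- A bounded solution of the backward equation agrees with its linearization up to a quadratic
error. -/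
theorem abs_backward_sub_le {N : ℕ} {v : Fin N → ℝ} (hv : ∀ i, 0 < v i)
    {w : (Fin N → ℤ) → ℝ → ℝ} {T C : ℝ} (hC : ∀ y, ∀ t ∈ Set.Icc 0 T, |w y t| ≤ C)
    (hw : ∀ y, StrictMono y → ∀ t, HasDerivAt (w y) (tasepGenerator v (fun y => w y t) y) t)
    {r s : ℝ} (hr : 0 ≤ r) (hrs : r ≤ s) (hs : s ≤ T) {y : Fin N → ℤ} (hy : StrictMono y) :
    |w y s - w y r - (s - r) * tasepGenerator v (fun y => w y r) y| ≤
      (2 * (∑ i, v i)) ^ 2 * C * (s - r) ^ 2 := by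
  set V := 2 * ∑ i, v i with hV
  have hV0 : 0 ≤ V := by
    have := Finset.sum_nonneg fun i (_ : i ∈ Finset.univ) => (hv i).le
    positivity
  have hC0 : 0 ≤ C := (abs_nonneg _).trans (hC y r ⟨hr, hrs.trans hs⟩)
  have hlip : ∀ z, StrictMono z → ∀ u ∈ Set.Icc r s, |w z u - w z r| ≤ V * C * (s - r) := by
    intro z hz u hu
    have := (convex_Icc r s).norm_image_sub_le_of_norm_hasDerivWithin_le
      (fun u _ => (hw z hz u).hasDerivWithinAt) (C := V * C) (fun u hu =>
        abs_tasepGenerator_le_of_bounded hv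
          (fun y => hC y u ⟨hr.trans hu.1, hu.2.trans hs⟩) z) (Set.left_mem_Icc.2 hrs) hu
    refine this.trans ?_
    rw [Real.norm_of_nonneg (sub_nonneg.2 hu.1)]
    have := hu.2
    gcongr
  -- The generator sees only `y` and its admissible hops, all strictly increasing, so `hlip` applies
  -- to each.
  have hgen : ∀ u ∈ Set.Icc r s,
      ‖tasepGenerator v (fun y => w y u) y - 1 * tasepGenerator v (fun y => w y r) y‖ ≤
        V * (V * C * (s - r)) := by
    intro u hu
    rw [one_mul, ← tasepGenerator_sub]
    exact abs_tasepGenerator_le hv (hlip y hy u hu) fun j hj => hlip _ (hy.update_add_one hj) u hu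
  have := (convex_Icc r s).norm_image_sub_le_of_norm_hasDerivWithin_le
    (f := fun u => w y u - (u - r) * tasepGenerator v (fun y => w y r) y)
    (fun u _ => ((hw y hy u).sub (((hasDerivAt_id u).sub_const r).mul_const _)).hasDerivWithinAt)
    hgen (Set.left_mem_Icc.2 hrs) (Set.right_mem_Icc.2 hrs)
  simp only [sub_self, zero_mul, sub_zero, Real.norm_eq_abs, abs_of_nonneg (sub_nonneg.2 hrs)] at this
  calc _ = |w y s - (s - r) * tasepGenerator v (fun y => w y r) y - w y r| := by congr 1; ring
    _ ≤ _ := this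
    _ = _ := by ring

/-- The smallest multiple of `1 / (n + 1)` that exceeds `s`. -/
noncomputable def upperApprox (n : ℕ) (s : ℝ≥0) : ℝ≥0 := (⌊s * (n + 1)⌋₊ + 1) / (n + 1)

theorem measurable_floor_mul_const (c : ℝ≥0) : Measurable fun s : ℝ≥0 => ⌊s * c⌋₊ :=
  Nat.measurable_floor.comp (measurable_id.mul_const c)

theorem exists_upperApprox_eq (n : ℕ) :
    ∃ (c : ℕ → ℝ≥0) (g : ℝ≥0 → ℕ), Measurable g ∧ ∀ s, upperApprox n s = c (g s) :=
  ⟨fun m => (m + 1) / (n + 1), fun s => ⌊s * (n + 1)⌋₊, measurable_floor_mul_const _, fun _ => rfl⟩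

theorem le_upperApprox (n : ℕ) (s : ℝ≥0) : s ≤ upperApprox n s := by
  have hn : (0 : ℝ≥0) < n + 1 := by positivity
  exact (le_div_iff₀ hn).2 (Nat.lt_floor_add_one _).le

theorem upperApprox_le (n : ℕ) (s : ℝ≥0) : upperApprox n s ≤ s + 1 / ((n : ℝ≥0) + 1) := by
  have hn : (0 : ℝ≥0) < n + 1 := by positivity
  have h : (⌊s * (n + 1)⌋₊ : ℝ≥0) ≤ s * (n + 1) := Nat.floor_le zero_le
  refine (div_le_iff₀ hn).2 ?_
  rw [add_mul, div_mul_cancel₀ _ hn.ne']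
  exact add_le_add_left h 1

theorem tendsto_upperApprox (s : ℝ≥0) :
    Filter.Tendsto (fun n => upperApprox n s) Filter.atTop (nhdsWithin s (Set.Ici s)) := by
  have h0 : Filter.Tendsto (fun n : ℕ => 1 / ((n : ℝ≥0) + 1)) Filter.atTop (nhds 0) := by
    rw [← NNReal.tendsto_coe]
    simpa using tendsto_one_div_add_atTop_nhds_zero_nat (𝕜 := ℝ)
  have hlim := h0.const_add s
  rw [add_zero] at hlim
  exact tendsto_nhdsWithin_iff.2 ⟨tendsto_of_tendsto_of_tendsto_of_le_of_le tendsto_const_nhds hlim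
    (le_upperApprox · s) (upperApprox_le · s), Filter.Eventually.of_forall (le_upperApprox · s)⟩

/-! ### Expectations along the process and duality with the backward equation -/

namespace IsTASEP

/-- Right-continuity makes the process a limit of versions sampled at countably many times. Joint
measurability is what Fubini requires below. -/
theorem measurable_uncurry_apply {ι : Type*} [LinearOrder ι] {r : ι → ℝ} {y : ι → ℤ} {Ω : Type*}
    {mΩ : MeasurableSpace Ω} {μ : Measure Ω} {ℱ : Filtration ℝ≥0 mΩ} {X : ℝ≥0 → Ω → ι → ℤ}
    (hX : IsTASEP r y μ ℱ X) (j : ι) : Measurable fun p : ℝ≥0 × Ω => X p.1 p.2 j := by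
  refine measurable_of_tendsto_metrizable
    (f := fun n (p : ℝ≥0 × Ω) => X (upperApprox n p.1) p.2 j) (fun n => ?_)
    (tendsto_pi_nhds.2 fun p =>
      (hX.rightContinuous p.2 j p.1).tendsto.comp (tendsto_upperApprox p.1))
  have key : ∀ (c : ℕ → ℝ≥0) (g : ℝ≥0 → ℕ), Measurable g →
      Measurable fun p : ℝ≥0 × Ω => X (c (g p.1)) p.2 j := fun c g hg => by
    have h : Measurable fun q : ℕ × Ω => X (c q.1) q.2 j :=
      measurable_from_prod_countable_right fun m => (hX.adapted (c m) j).mono (ℱ.le _) le_rfl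
    exact h.comp ((hg.comp measurable_fst).prodMk measurable_snd)
  obtain ⟨c, g, hg, hcg⟩ := exists_upperApprox_eq n
  simp only [hcg]
  exact key c g hg

variable {N : ℕ} {v : Fin N → ℝ} {y : Fin N → ℤ} {Ω : Type*} {mΩ : MeasurableSpace Ω}
  {μ : Measure Ω} [IsProbabilityMeasure μ] {ℱ : Filtration ℝ≥0 mΩ} {X : ℝ≥0 → Ω → Fin N → ℤ}

omit [IsProbabilityMeasure μ] in
theorem measurable_uncurry_comp (hX : IsTASEP v y μ ℱ X) (f : (Fin N → ℤ) → ℝ) :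
    Measurable fun p : ℝ × Ω => f (X p.1.toNNReal p.2) := by
  have h : Measurable fun p : ℝ × Ω => X p.1.toNNReal p.2 := measurable_pi_lambda _ fun j =>
    (hX.measurable_uncurry_apply j).comp
      ((measurable_real_toNNReal.comp measurable_fst).prodMk measurable_snd)
  exact (Measurable.of_discrete (f := f)).comp h

omit [IsProbabilityMeasure μ] in
theorem measurable_comp (hX : IsTASEP v y μ ℱ X) (f : (Fin N → ℤ) → ℝ) (s : ℝ≥0) :
    Measurable fun ω => f (X s ω) := by
  have h : Measurable fun ω => X s ω :=
    measurable_pi_lambda _ fun j => (hX.adapted s j).mono (ℱ.le _) le_rfl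
  exact (Measurable.of_discrete (f := f)).comp h

theorem integrable_comp (hX : IsTASEP v y μ ℱ X) {f : (Fin N → ℤ) → ℝ} {C : ℝ}
    (hC : ∀ y, StrictMono y → |f y| ≤ C) (s : ℝ≥0) : Integrable (fun ω => f (X s ω)) μ :=
  Integrable.of_bound (hX.measurable_comp f s).aestronglyMeasurable C
    (Filter.Eventually.of_forall fun ω => hC _ (hX.strictMono s ω))

theorem abs_integral_comp_le (hX : IsTASEP v y μ ℱ X) {f : (Fin N → ℤ) → ℝ} {C : ℝ}
    (hC : ∀ y, StrictMono y → |f y| ≤ C) (s : ℝ≥0) : |∫ ω, f (X s ω) ∂μ| ≤ C := by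
  simpa using norm_integral_le_of_norm_le_const (μ := μ)
    (Filter.Eventually.of_forall fun ω =>
      (Real.norm_eq_abs (f (X s ω))).trans_le (hC _ (hX.strictMono s ω)))

/-- Dynkin's formula: constancy of the martingale's expectation, then Fubini. -/
theorem integral_comp_sub (hv : ∀ i, 0 < v i) (hX : IsTASEP v y μ ℱ X) {f : (Fin N → ℤ) → ℝ}
    {C : ℝ} (hC : ∀ y, |f y| ≤ C) {a b : ℝ} (ha : 0 ≤ a) (hab : a ≤ b) :
    (∫ ω, f (X b.toNNReal ω) ∂μ) - ∫ ω, f (X a.toNNReal ω) ∂μ =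
      ∫ s in a..b, ∫ ω, tasepGenerator v f (X s.toNNReal ω) ∂μ := by
  have hb : 0 ≤ b := ha.trans hab
  set g := tasepGenerator v f
  have hg : ∀ y, |g y| ≤ 2 * (∑ i, v i) * C := abs_tasepGenerator_le_of_bounded hv hC
  have hprod : ∀ c d : ℝ, Integrable (fun p : ℝ × Ω => g (X p.1.toNNReal p.2))
      ((volume.restrict (Set.uIoc c d)).prod μ) := fun c d =>
    Integrable.of_bound (hX.measurable_uncurry_comp g).aestronglyMeasurable _
      (Filter.Eventually.of_forall fun p => hg _)
  have hpath : ∀ (ω : Ω) (c d : ℝ),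
      IntervalIntegrable (fun s : ℝ => g (X s.toNNReal ω)) volume c d := fun ω c d => by
    rw [intervalIntegrable_iff]
    exact Integrable.of_bound ((hX.measurable_uncurry_comp g).comp
      measurable_prodMk_right).aestronglyMeasurable _ (Filter.Eventually.of_forall fun p => hg _)
  have hM := hX.martingale Finset.univ f (by simpa using dependsOn_univ f) ⟨C, hC⟩
  have hE := hM.setIntegral_eq (Real.toNNReal_le_toNNReal hab) MeasurableSet.univ
  simp only [setIntegral_univ, Real.coe_toNNReal a ha, Real.coe_toNNReal b hb] at hE
  have hf : ∀ s : ℝ≥0, Integrable (fun ω => f (X s ω)) μ :=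
    hX.integrable_comp fun y _ => hC y
  have hI : ∀ c : ℝ, Integrable (fun ω => ∫ s in (0 : ℝ)..c, g (X s.toNNReal ω)) μ := fun c => by
    simp only [intervalIntegral.intervalIntegral_eq_integral_uIoc]
    exact ((hprod 0 c).integral_prod_right).fun_smul _
  rw [integral_sub (hf _) (hI a), integral_sub (hf _) (hI b)] at hE
  rw [intervalIntegral_integral_swap (hprod a b)]
  have hsplit : ∀ ω, ∫ s in a..b, g (X s.toNNReal ω) =
      (∫ s in (0 : ℝ)..b, g (X s.toNNReal ω)) - ∫ s in (0 : ℝ)..a, g (X s.toNNReal ω) := fun ω =>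
    (intervalIntegral.integral_interval_sub_left (hpath ω _ _) (hpath ω _ _)).symm
  simp only [hsplit]
  rw [integral_sub (hI b) (hI a)]
  linarith

theorem abs_integral_comp_sub_le (hv : ∀ i, 0 < v i) (hX : IsTASEP v y μ ℱ X)
    {f : (Fin N → ℤ) → ℝ} {C : ℝ} (hC : ∀ y, |f y| ≤ C) {a b : ℝ} (ha : 0 ≤ a) (hab : a ≤ b) :
    |(∫ ω, f (X b.toNNReal ω) ∂μ) - ∫ ω, f (X a.toNNReal ω) ∂μ| ≤
      2 * (∑ i, v i) * C * (b - a) := by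
  rw [hX.integral_comp_sub hv hC ha hab, ← Real.norm_eq_abs]
  refine (intervalIntegral.norm_integral_le_of_norm_le_const fun s _ =>
    hX.abs_integral_comp_le (fun y _ => abs_tasepGenerator_le_of_bounded hv hC y) _).trans_eq ?_
  rw [abs_of_nonneg (sub_nonneg.2 hab)]

/-- The generator maps bounded functions to bounded functions, so the Lipschitz estimate also
applies to `tasepGenerator v f`. -/
theorem abs_integral_comp_sub_sub_le (hv : ∀ i, 0 < v i) (hX : IsTASEP v y μ ℱ X)
    {f : (Fin N → ℤ) → ℝ} {C : ℝ} (hC : ∀ y, |f y| ≤ C) {a b : ℝ} (ha : 0 ≤ a) (hab : a ≤ b) :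
    |(∫ ω, f (X b.toNNReal ω) ∂μ) - (∫ ω, f (X a.toNNReal ω) ∂μ) -
      (b - a) * ∫ ω, tasepGenerator v f (X a.toNNReal ω) ∂μ| ≤
      (2 * (∑ i, v i)) ^ 2 * C * (b - a) ^ 2 := by
  have hg := abs_tasepGenerator_le_of_bounded hv hC
  have hint : IntervalIntegrable
      (fun s : ℝ => ∫ ω, tasepGenerator v f (X s.toNNReal ω) ∂μ) volume a b := by
    rw [intervalIntegrable_iff]
    exact Integrable.of_bound (hX.measurable_uncurry_comp
      (tasepGenerator v f)).stronglyMeasurable.integral_prod_right.aestronglyMeasurable _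
      (Filter.Eventually.of_forall fun s => hX.abs_integral_comp_le (fun y _ => hg y) _)
  have hV0 : 0 ≤ 2 * ∑ i, v i := by
    have := Finset.sum_nonneg fun i (_ : i ∈ Finset.univ) => (hv i).le
    positivity
  have hC0 : 0 ≤ C := (abs_nonneg _).trans (hC 0)
  rw [hX.integral_comp_sub hv hC ha hab, ← smul_eq_mul (b - a),
    ← intervalIntegral.integral_const, ← intervalIntegral.integral_sub hint (by simp), ← Real.norm_eq_abs]
  refine (intervalIntegral.norm_integral_le_of_norm_le_const
    (C := 2 * (∑ i, v i) * (2 * (∑ i, v i) * C) * (b - a)) fun s hs => ?_).trans_eq ?_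
  · rw [Set.uIoc_of_le hab] at hs
    refine (hX.abs_integral_comp_sub_le hv hg ha hs.1.le).trans ?_
    have := hs.2
    gcongr
  · rw [abs_of_nonneg (sub_nonneg.2 hab)]
    ring

/-- Along a TASEP, the expectation of a bounded solution of the backward equation is conserved. -/
theorem integral_backward_eq (hv : ∀ i, 0 < v i) (hX : IsTASEP v y μ ℱ X)
    {w : (Fin N → ℤ) → ℝ → ℝ} {T C : ℝ} (hT : 0 ≤ T)
    (hC : ∀ y, ∀ t ∈ Set.Icc 0 T, |w y t| ≤ C)
    (hw : ∀ y, StrictMono y → ∀ t, HasDerivAt (w y) (tasepGenerator v (fun y => w y t) y) t) :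
    ∫ ω, w (X T.toNNReal ω) 0 ∂μ = w y T := by
  set K := (2 * (∑ i, v i)) ^ 2 * C
  have hmain := eq_of_abs_sub_le_sq (g := fun s => ∫ ω, w (X s.toNNReal ω) (T - s) ∂μ)
    (K := K + K) hT fun a b ha hab hb => ?_
  · simp only [sub_self, sub_zero, Real.toNNReal_zero] at hmain
    rw [hmain, integral_congr_ae (hX.initial.mono fun ω hω => by simp only [hω])
      (g := fun _ => w y T)]
    simp
  · have hTb : T - b ∈ Set.Icc 0 T := ⟨by linarith, by linarith⟩
    have hTa : T - a ∈ Set.Icc 0 T := ⟨by linarith, by linarith⟩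
    -- Both expansions use the solution frozen at `T - b`: `h1` moves the process from `a` to `b`,
    -- `h2` moves the time of `w` at fixed `X a`. Their linear terms cancel.
    set g := tasepGenerator v fun y => w y (T - b)
    have h1 := hX.abs_integral_comp_sub_sub_le hv (fun y => hC y _ hTb) ha hab
    have hb' : ∀ z, StrictMono z →
        |w z (T - a) - w z (T - b) - (b - a) * g z| ≤ K * (b - a) ^ 2 := fun z hz => by
      have := abs_backward_sub_le hv hC hw hTb.1 (by linarith : T - b ≤ T - a) hTa.2 hz
      rwa [show T - a - (T - b) = b - a by ring] at this
    have h2 := hX.abs_integral_comp_le hb' a.toNNReal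
    have hg : Integrable (fun ω => g (X a.toNNReal ω)) μ :=
      hX.integrable_comp (fun z _ => abs_tasepGenerator_le_of_bounded hv (fun y => hC y _ hTb) z) _
    have hwa : Integrable (fun ω => w (X a.toNNReal ω) (T - a)) μ :=
      hX.integrable_comp (f := fun y => w y (T - a)) (fun z _ => hC z _ hTa) _
    have hwb : Integrable (fun ω => w (X a.toNNReal ω) (T - b)) μ :=
      hX.integrable_comp (f := fun y => w y (T - b)) (fun z _ => hC z _ hTb) _
    rw [integral_sub (hwa.sub' hwb) (hg.const_mul _), integral_sub hwa hwb,
      integral_const_mul] at h2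
    rw [abs_le] at h1 h2 ⊢
    constructor <;> linarith [h1.1, h1.2, h2.1, h2.2]

/-- The probability that all particles are at or to the right of `x`. -/
theorem measureReal_forall_le_eq {ε : ℝ} (hε : 0 < ε) (hv : ∀ i, 0 < v i)
    (hεv : ∀ i, ε * v i < 1) (hX : IsTASEP v y μ ℱ X) (t : ℝ≥0) (x : ℤ) :
    (μ.real {ω | ∀ i, x ≤ X t ω i} : ℂ) = tasepProb v ε x y t := by
  obtain ⟨C, hC⟩ := exists_norm_tasepProb_le hε hv hεv x t
  have key : ∀ φ : ℂ →L[ℝ] ℝ, ‖φ‖ ≤ 1 →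
      μ.real {ω | ∀ i, x ≤ X t ω i} * φ 1 = φ (tasepProb v ε x y t) := by
    intro φ hφ
    rw [← hX.integral_backward_eq hv (w := fun y t => φ (tasepProb v ε x y t)) t.coe_nonneg
      (fun y s hs => (φ.le_of_opNorm_le hφ _).trans (by simpa using hC y s hs))
      fun y hy s => hasDerivAt_tasepProb hε hv hεv φ x hy s]
    have hset : MeasurableSet {ω | ∀ i, x ≤ X t ω i} := by
      simp only [Set.ofPred_forall]
      exact MeasurableSet.iInter fun i =>
        ((hX.adapted t i).mono (ℱ.le _) le_rfl) (measurableSet_Ici (a := x))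
    rw [← smul_eq_mul, ← integral_indicator_const _ hset]
    refine integral_congr_ae (Filter.Eventually.of_forall fun ω => ?_)
    simp only [Real.toNNReal_coe, tasepProb_zero_time hε hv hεv x (hX.strictMono t ω)]
    by_cases h : ∀ i, x ≤ X t ω i <;> simp [h]
  have hre := key Complex.reCLM (by simp)
  have him := key Complex.imCLM (by simp)
  apply Complex.ext
  · simpa using hre
  · simpa using him

end IsTASEP

/-! ### Restriction to the rightmost particles -/

open Classical in
theorem tasepGenerator_eq_tsum {ι : Type*} [DecidableEq ι] (r : ι → ℝ) (f : (ι → ℤ) → ℝ)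
    (x : ι → ℤ) : tasepGenerator r f x = ∑' j, if ∀ k, x k ≠ x j + 1 then
      r j * (f (Function.update x j (x j + 1)) - f x) else 0 := by
  rw [tasepGenerator]
  refine tsum_congr fun j => ?_
  congr!

/-- Only a particle further right can block, and the range of `e` is closed to the right; hops of
the other particles do not change `x ∘ e`. -/
theorem tasepGenerator_comp {ι κ : Type*} [LinearOrder ι] [LinearOrder κ] {e : κ → ι}
    (he : StrictMono e) (hupper : ∀ i j, e i ≤ j → j ∈ Set.range e) (r : ι → ℝ)
    (f : (κ → ℤ) → ℝ) {x : ι → ℤ} (hx : StrictMono x) :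
    tasepGenerator r (fun x => f (x ∘ e)) x = tasepGenerator (r ∘ e) f (x ∘ e) := by
  classical
  rw [tasepGenerator_eq_tsum, tasepGenerator_eq_tsum, ← he.injective.tsum_eq]
  · refine tsum_congr fun i => ?_
    have hcond : (∀ k, x k ≠ x (e i) + 1) ↔ ∀ k, (x ∘ e) k ≠ (x ∘ e) i + 1 := by
      refine ⟨fun h k => h (e k), fun h k hk => ?_⟩
      obtain ⟨k, rfl⟩ := hupper i k (hx.lt_iff_lt.1 (by omega)).le
      exact h k hk
    simp only [hcond]
    rw [Function.update_comp_eq_of_injective _ he.injective]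
    rfl
  · refine Function.support_subset_iff'.2 fun j hj => ?_
    rw [Function.update_comp_eq_of_notMem_range _ _ hj]
    simp

theorem IsTASEP.comp {ι κ : Type*} [LinearOrder ι] [LinearOrder κ] {e : κ → ι}
    (he : StrictMono e) (hupper : ∀ i j, e i ≤ j → j ∈ Set.range e) {r : ι → ℝ} {y : ι → ℤ}
    {Ω : Type*} {mΩ : MeasurableSpace Ω} {μ : Measure Ω} {ℱ : Filtration ℝ≥0 mΩ}
    {X : ℝ≥0 → Ω → ι → ℤ} (hX : IsTASEP r y μ ℱ X) :
    IsTASEP (r ∘ e) (y ∘ e) μ ℱ fun t ω => X t ω ∘ e where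
  strictMono t ω := (hX.strictMono t ω).comp he
  adapted t j := hX.adapted t (e j)
  rightContinuous ω j t := hX.rightContinuous ω (e j) t
  initial := hX.initial.mono fun ω hω => by simp only [hω]
  martingale S f hf hC := by
    classical
    obtain ⟨C, hC⟩ := hC
    have h := hX.martingale (S.image e) (fun x => f (x ∘ e))
      (fun x z hxz => hf fun i hi => hxz (e i) (by simpa using ⟨i, hi, rfl⟩)) ⟨C, fun x => hC _⟩
    simpa only [tasepGenerator_comp he hupper r f (hX.strictMono _ _)] using h

/-- The labels of the `N` rightmost particles of the step initial condition, from left to right. -/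
def rightmostLabel (N : ℕ) (i : Fin N) : ℕᵒᵈ := OrderDual.toDual (i.rev : ℕ)

theorem strictMono_rightmostLabel (N : ℕ) : StrictMono (rightmostLabel N) := fun _ _ h =>
  OrderDual.toDual_lt_toDual.2 (Fin.rev_lt_rev.2 h)

theorem mem_range_rightmostLabel {N : ℕ} {j : ℕᵒᵈ} :
    j ∈ Set.range (rightmostLabel N) ↔ OrderDual.ofDual j < N := by
  refine ⟨?_, fun h => ⟨(⟨OrderDual.ofDual j, h⟩ : Fin N).rev, by simp [rightmostLabel]⟩⟩
  rintro ⟨i, rfl⟩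
  exact i.rev.isLt

theorem stepConfig_comp_rightmostLabel (N : ℕ) :
    stepConfig ∘ rightmostLabel N = blockConfig N := by
  ext i
  simp only [Function.comp_apply, stepConfig, rightmostLabel, blockConfig, OrderDual.ofDual_toDual,
    Fin.val_rev]
  omega

theorem hasCrossed_iff_le {ι : Type*} {ξ : ℝ≥0 → ι → ℤ} {x : ℤ} (h0 : ∀ j, ξ 0 j ≤ 0)
    (hx : 1 ≤ x) (t : ℝ≥0) (j : ι) : HasCrossed ξ x t j ↔ x ≤ ξ t j := by
  have := h0 j
  exact ⟨fun h => h.2, fun h => ⟨by omega, h⟩⟩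

/-- The particles at sites `≥ x` form a block of rightmost labels, and the `N`-th label from the
right is `N - 1`. -/
theorem natCast_le_encard_iff {N : ℕ} (hN : 1 ≤ N) {y : ℕᵒᵈ → ℤ} (hy : StrictMono y) (x : ℤ) :
    (N : ℕ∞) ≤ {j | x ≤ y j}.encard ↔ x ≤ y (OrderDual.toDual (N - 1)) := by
  constructor
  · intro h
    by_contra! hlt
    have hsub : {j | x ≤ y j} ⊆ Set.range (rightmostLabel (N - 1)) := fun j hj => by
      rw [mem_range_rightmostLabel]
      have : OrderDual.toDual (N - 1) < j := hy.lt_iff_lt.1 (hlt.trans_le hj)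
      exact this
    have h1 := h.trans (Set.encard_le_encard hsub)
    rw [← Set.image_univ, (strictMono_rightmostLabel _).injective.encard_image,
      Set.encard_univ] at h1
    simp only [ENat.card_eq_coe_fintype_card, Fintype.card_fin] at h1
    have : N ≤ N - 1 := by exact_mod_cast h1
    omega
  · intro h
    have hsub : Set.range (rightmostLabel N) ⊆ {j | x ≤ y j} := fun j hj => by
      rw [mem_range_rightmostLabel] at hj
      refine h.trans (hy.monotone ?_)
      exact OrderDual.toDual_le.2 (by omega : OrderDual.ofDual j ≤ N - 1)
    refine le_trans (le_of_eq ?_) (Set.encard_le_encard hsub)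
    rw [← Set.image_univ, (strictMono_rightmostLabel _).injective.encard_image, Set.encard_univ]
    simp


/-! ### The current distribution -/

theorem measureReal_forall_le_eq_tasepQ {N : ℕ} {v : Fin N → ℝ} {ε : ℝ} (hε : 0 < ε)
    (hv : ∀ i, 0 < v i) (hεv : ∀ i, ε * v i < 1) {Ω : Type*} {mΩ : MeasurableSpace Ω}
    {μ : Measure Ω} [IsProbabilityMeasure μ] {ℱ : Filtration ℝ≥0 mΩ} {X : ℝ≥0 → Ω → Fin N → ℤ}
    (hX : IsTASEP v (blockConfig N) μ ℱ X) (t : ℝ≥0) (x : ℤ) :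
    (μ.real {ω | ∀ i, x ≤ X t ω i} : ℂ) = tasepQ v ε x t := by
  rw [tasepQ_eq_tasepProb hε hv hεv, hX.measureReal_forall_le_eq hε hv hεv]

theorem theorem2 (N : ℕ) (hN : 1 ≤ N) (v : Fin N → ℝ) (hv : ∀ i, 0 < v i)
    (ε : ℝ) (hε : 0 < ε) (hεv : ∀ i, ε * v i < 1) :
    -- `N` particles started from `(1 - N, …, 0)`
    (∀ {Ω : Type*} {mΩ : MeasurableSpace Ω} (μ : Measure Ω) [IsProbabilityMeasure μ]
      (ℱ : Filtration ℝ≥0 mΩ) (X : ℝ≥0 → Ω → Fin N → ℤ),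
      IsTASEP v (blockConfig N) μ ℱ X → ∀ (t : ℝ≥0) (x : ℤ),
        (μ.real {ω | ∀ i, x ≤ X t ω i} : ℂ) = tasepQ v ε x t ∧
        (1 ≤ x → (μ.real {ω | ∀ i, HasCrossed (fun s => X s ω) x t i} : ℂ) = tasepQ v ε x t)) ∧
    -- the step initial condition, where `v` lists the rates of the `N` rightmost particles
    (∀ (r : ℕᵒᵈ → ℝ), (∀ j, 0 < r j) → (∀ i : Fin N, r (OrderDual.toDual (i.rev : ℕ)) = v i) →
      ∀ {Ω : Type*} {mΩ : MeasurableSpace Ω} (μ : Measure Ω) [IsProbabilityMeasure μ]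
      (ℱ : Filtration ℝ≥0 mΩ) (X : ℝ≥0 → Ω → ℕᵒᵈ → ℤ),
      IsTASEP r stepConfig μ ℱ X → ∀ (t : ℝ≥0) (x : ℤ),
        (μ.real {ω | x ≤ X t ω (OrderDual.toDual (N - 1))} : ℂ) = tasepQ v ε x t ∧
        (1 ≤ x → (μ.real {ω | (N : ℕ∞) ≤ {j | HasCrossed (fun s => X s ω) x t j}.encard} : ℂ)
          = tasepQ v ε x t)) := by
  refine ⟨fun μ _ ℱ X hX t x => ⟨measureReal_forall_le_eq_tasepQ hε hv hεv hX t x, fun hx => ?_⟩,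
    fun r _ hrv Ω mΩ μ _ ℱ X hX t x => ?_⟩
  · rw [← measureReal_forall_le_eq_tasepQ hε hv hεv hX t x]
    congr 1
    refine measureReal_congr (hX.initial.mono fun ω hω => propext (forall_congr' fun i => ?_))
    refine hasCrossed_iff_le (fun j => ?_) hx t i
    simp only [hω, blockConfig]
    omega
  · have hcomp := hX.comp (strictMono_rightmostLabel N) fun i j hij => by
      rw [mem_range_rightmostLabel]
      exact lt_of_le_of_lt (OrderDual.ofDual_le_ofDual.2 hij) i.rev.isLt
    rw [stepConfig_comp_rightmostLabel, show r ∘ rightmostLabel N = v from funext hrv] at hcomp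
    have hfirst : (μ.real {ω | x ≤ X t ω (OrderDual.toDual (N - 1))} : ℂ) = tasepQ v ε x t := by
      rw [← measureReal_forall_le_eq_tasepQ hε hv hεv hcomp t x]
      congr 2
      ext ω
      -- The `N`-th particle from the right is the leftmost of the `N` retained, so its position
      -- bounds the others from below.
      refine ⟨fun h i => h.trans ((hX.strictMono t ω).monotone ?_), fun h => ?_⟩
      · exact OrderDual.toDual_le_toDual.2 (by have := i.rev.isLt; omega)
      · simpa [rightmostLabel] using h ⟨0, hN⟩
    refine ⟨hfirst, fun hx => ?_⟩
    rw [← hfirst]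
    congr 1
    refine measureReal_congr (hX.initial.mono fun ω hω => propext ?_)
    refine Iff.trans ?_ (natCast_le_encard_iff hN (hX.strictMono t ω) x)
    have hset : {j | HasCrossed (fun s => X s ω) x t j} = {j | x ≤ X t ω j} :=
      congrArg _ (funext fun j => propext
        (hasCrossed_iff_le (ξ := fun s => X s ω) (fun j => by simp [hω, stepConfig]) hx t j))
    exact iff_of_eq (congrArg (fun s : Set ℕᵒᵈ => (N : ℕ∞) ≤ s.encard) hset)
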